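/- Let $\alpha<1$ and $\varepsilon>0$. There is a constant $C>0$, depending only on $\alpha$ and $\varepsilon$, such that the following holds for all dimensions $m,n$ with $m\le\alpha n$. Let $f:\mathbb{R}^n\to\mathbb{R}$ be Lipschitz continuous with constant $L>0$ with respect to the Euclidean norm, i.e. $|f(\mathbf{x})-f(\mathbf{x}')|\le L\|\mathbf{x}-\mathbf{x}'\|$, let $\mathbf{x}_0\in\mathbb{R}^n$ and $\sigma\in\mathbb{R}$, and let $\mathbf{y}=\mathbf{A}\mathbf{x}_0+\mathbf{z}$, where $\mathbf{A}\in\mathbb{R}^{m\times n}$ has independent standard normal entries and $\mathbf{z}\sim\mathcal{N}(0,\sigma^2\mathbf{I}_m)$ is independent of $\mathbf{A}$. Let $$0\le\lambda<\frac{\sqrt n-\sqrt m}{L}\,(1-\varepsilon).$$ Then, with probability at least $1-\exp(-Cn)$, every solution $$\mathbf{x}^*_{\ell_2}\in\arg\min_{\mathbf{x}\in\mathbb{R}^n}\left\{\|\mathbf{y}-\mathbf{A}\mathbf{x}\|+\lambda f(\mathbf{x})\right\}$$ of the $\ell_2$-LASSO satisfies $\mathbf{y}=\mathbf{A}\mathbf{x}^*_{\ell_2}$,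 and moreover, if $\lambda>0$, the $\ell_2$-LASSO reduces to noiseless $f$-minimization: its solutions are exactly the solutions of $$\min_{\mathbf{x}\in\mathbb{R}^n} f(\mathbf{x})\quad\text{subject to}\quad\mathbf{y}=\mathbf{A}\mathbf{x}.$$ -/

import Mathlib

open MeasureTheory ProbabilityTheory

namespace EllTwoLasso

/-- The objective `‖y - A x‖ + lam * f x` of the `ℓ₂`-LASSO (Euclidean norm, not squared). -/
noncomputable def cost {m n : ℕ} (f : EuclideanSpace ℝ (Fin n) → ℝ) (lam : ℝ)
    (A : Matrix (Fin m) (Fin n) ℝ) (y : EuclideanSpace ℝ (Fin m))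
    (x : EuclideanSpace ℝ (Fin n)) : ℝ :=
  ‖y - Matrix.toEuclideanLin A x‖ + lam * f x

/-- `x` is a solution of the `ℓ₂`-LASSO: a global minimizer of its objective. -/
def IsSolution {m n : ℕ} (f : EuclideanSpace ℝ (Fin n) → ℝ) (lam : ℝ)
    (A : Matrix (Fin m) (Fin n) ℝ) (y : EuclideanSpace ℝ (Fin m))
    (x : EuclideanSpace ℝ (Fin n)) : Prop :=
  ∀ x' : EuclideanSpace ℝ (Fin n), cost f lam A y x ≤ cost f lam A y x'

/-- `x` solves the noiseless problem `min f(x)` subject to `y = A x`. -/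
def IsNoiselessSolution {m n : ℕ} (f : EuclideanSpace ℝ (Fin n) → ℝ)
    (A : Matrix (Fin m) (Fin n) ℝ) (y : EuclideanSpace ℝ (Fin m))
    (x : EuclideanSpace ℝ (Fin n)) : Prop :=
  y = Matrix.toEuclideanLin A x ∧
    ∀ x' : EuclideanSpace ℝ (Fin n), y = Matrix.toEuclideanLin A x' → f x ≤ f x'

/-- The measurement matrix `A` has independent standard normal entries, the noise `z` has law
`N(0, σ² I)`, and `A` and `z` are independent. -/
structure IsGaussianModel {Ω : Type*} [MeasurableSpace Ω] (μ : Measure Ω) {m n : ℕ} (σ : ℝ)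
    (A : Ω → Matrix (Fin m) (Fin n) ℝ) (z : Ω → EuclideanSpace ℝ (Fin m)) : Prop where
  entry_law : ∀ i j, HasLaw (fun ω => A ω i j) (gaussianReal 0 1) μ
  entry_indep : iIndepFun (fun (p : Fin m × Fin n) (ω : Ω) => A ω p.1 p.2) μ
  noise_law :
    HasLaw z (multivariateGaussian 0 (σ ^ 2 • (1 : Matrix (Fin m) (Fin m) ℝ))) μ
  indep : IndepFun (fun ω (p : Fin m × Fin n) => A ω p.1 p.2) z μ

end EllTwoLasso

namespace EllTwoLasso

open Matrix

/-! The deterministic core is `exact_recovery_of_notMem_badSet`. Suppose `s |u| ≤ |uᵀA|` for all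
`u`, with `s > lam * L`. A nonzero residual `w = y - A x` then equals `A h` for some `h` with `s ‖h‖
≤ ‖w‖`, and moving to `x + h` removes `‖w‖` from the cost while raising `lam * f` by at most `lam *
L * ‖h‖ < ‖w‖`. So minimizers are feasible, and on feasible points the cost is `lam * f`.

It remains to bound the smallest singular value below by `(1 - ε)(√n - √m)` with exponentially high
probability. `gaussMat_badSet_le` does this by induction on `m` with `n - m` fixed, for the stronger
inequality `s |u|² + c ⟨v, u⟩² ≤ |uᵀA|²`. Rotations make `v` and the first row multiples of the
first basis vector, leaving an independent Gaussian column `b` and a smaller Gaussian matrix `B`.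
Completing a square turns the claim for `A` into the same claim for `B`, with `v` proportional to
`b`; the rank-one term is what closes the induction. Each step fails only if the row is too short or
`b` too long, which the chi tails control.

This settles large `n`. The finitely many remaining pairs `(m, n)` need only a failure probability
below one (`gaussMat_badSet_lt_one`), after which `C` is shrunk. -/

/-- The standard Gaussian measure on `ℝⁿ`. -/
noncomputable def gaussVec (n : ℕ) : Measure (Fin n → ℝ) :=
  Measure.pi fun _ => gaussianReal 0 1

/-- The law of an `m × n` matrix with independent standard normal entries. -/
noncomputable def gaussMat (m n : ℕ) : Measure (Fin m → Fin n → ℝ) :=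
  Measure.pi fun _ => gaussVec n

instance isProbabilityMeasure_gaussVec (n : ℕ) : IsProbabilityMeasure (gaussVec n) := by
  unfold gaussVec; infer_instance

instance isProbabilityMeasure_gaussMat (m n : ℕ) : IsProbabilityMeasure (gaussMat m n) := by
  unfold gaussMat; infer_instance

/-! ### Chi tails -/

lemma gaussianPDFReal_mul_exp_sq {r : ℝ} (hr : 0 < r) (x : ℝ) :
    gaussianPDFReal 0 1 x * Real.exp ((1 - 1 / r ^ 2) / 2 * x ^ 2)
      = (√(2 * Real.pi))⁻¹ * Real.exp (-(1 / (2 * r ^ 2)) * x ^ 2) := by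
  rw [gaussianPDFReal, mul_assoc, ← Real.exp_add]
  simp only [NNReal.coe_one, mul_one, sub_zero]
  congr 2
  field_simp
  ring

lemma integrable_exp_sq_gaussianReal {r : ℝ} (hr : 0 < r) :
    Integrable (fun x : ℝ => Real.exp ((1 - 1 / r ^ 2) / 2 * x ^ 2)) (gaussianReal 0 1) := by
  rw [gaussianReal_of_var_ne_zero _ one_ne_zero, gaussianPDF_def,
    integrable_withDensity_iff_integrable_smul₀' (by fun_prop) (by simp)]
  simp only [smul_eq_mul, ENNReal.toReal_ofReal (gaussianPDFReal_nonneg _ _ _),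
    gaussianPDFReal_mul_exp_sq hr]
  exact (integrable_exp_neg_mul_sq (by positivity)).const_mul _

lemma integral_exp_sq_gaussianReal {r : ℝ} (hr : 0 < r) :
    ∫ x, Real.exp ((1 - 1 / r ^ 2) / 2 * x ^ 2) ∂(gaussianReal 0 1) = r := by
  rw [integral_gaussianReal_eq_integral_smul one_ne_zero]
  simp only [smul_eq_mul, gaussianPDFReal_mul_exp_sq hr]
  rw [integral_const_mul, integral_gaussian]
  have : Real.pi / (1 / (2 * r ^ 2)) = 2 * Real.pi * r ^ 2 := by field_simp
  rw [this, Real.sqrt_mul (by positivity : (0 : ℝ) ≤ 2 * Real.pi) (r ^ 2), Real.sqrt_sq hr.le]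
  have := Real.sqrt_pos.2 (by positivity : 0 < 2 * Real.pi)
  field_simp

lemma exp_mul_dotProduct_self (n : ℕ) (t : ℝ) (x : Fin n → ℝ) :
    Real.exp (t * (x ⬝ᵥ x)) = ∏ i, Real.exp (t * x i ^ 2) := by
  rw [← Real.exp_sum, dotProduct, Finset.mul_sum]
  simp [sq]

lemma integrable_exp_dotProduct_self (n : ℕ) {r : ℝ} (hr : 0 < r) :
    Integrable (fun x : Fin n → ℝ => Real.exp ((1 - 1 / r ^ 2) / 2 * (x ⬝ᵥ x)))
      (gaussVec n) := by
  simp only [exp_mul_dotProduct_self]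
  exact Integrable.fintype_prod (f := fun _ y => Real.exp ((1 - 1 / r ^ 2) / 2 * y ^ 2))
    fun _ => integrable_exp_sq_gaussianReal hr

lemma mgf_dotProduct_self (n : ℕ) {r : ℝ} (hr : 0 < r) :
    mgf (fun x : Fin n → ℝ => x ⬝ᵥ x) (gaussVec n) ((1 - 1 / r ^ 2) / 2) = r ^ n := by
  simp only [mgf, exp_mul_dotProduct_self, gaussVec]
  rw [integral_fintype_prod_eq_pow (fun y : ℝ => Real.exp ((1 - 1 / r ^ 2) / 2 * y ^ 2)),
    integral_exp_sq_gaussianReal hr, Fintype.card_fin]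

/-- The Chernoff bound for both chi tails: since `r ≤ exp (r - 1)`, the exponent is at most `-n(r² -
1)/2 + n(r - 1) = -n(r - 1)²/2`. -/
lemma exp_mul_pow_le {n : ℕ} {η r : ℝ} (hr : 0 < r) (h : n * (r - 1) ^ 2 = η ^ 2) :
    Real.exp (-((1 - 1 / r ^ 2) / 2) * (n * r ^ 2)) * r ^ n ≤ Real.exp (-(η ^ 2 / 2)) := by
  have h1 : r ^ n ≤ Real.exp (n * (r - 1)) := by
    rw [Real.exp_nat_mul]
    exact pow_le_pow_left₀ hr.le (by linarith [Real.add_one_le_exp (r - 1)]) n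
  refine (mul_le_mul_of_nonneg_left h1 (Real.exp_pos _).le).trans ?_
  rw [← Real.exp_add, ← h]
  apply le_of_eq
  congr 1
  field_simp
  ring

lemma gaussVec_le_dotProduct_self (n : ℕ) {η : ℝ} (hη : 0 < η) :
    gaussVec n {x | (√n + η) ^ 2 ≤ x ⬝ᵥ x} ≤ ENNReal.ofReal (Real.exp (-(η ^ 2 / 2))) := by
  rcases n.eq_zero_or_pos with rfl | hn
  · have : {x : Fin 0 → ℝ | (√(0 : ℕ) + η) ^ 2 ≤ x ⬝ᵥ x} = ∅ := by
      ext x; simp [hη.ne']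
    rw [this, measure_empty]
    exact zero_le
  have hs : 0 < √(n : ℝ) := Real.sqrt_pos.2 (by exact_mod_cast hn)
  have hsq : √(n : ℝ) ^ 2 = n := Real.sq_sqrt (by positivity)
  -- The threshold becomes `n r²`, and the tilt `(1 - 1/r²)/2` is the optimal Chernoff parameter for
  -- it.
  set r := 1 + η / √n with hr_def
  have hr : 0 < r := by positivity
  have e1 : (√(n : ℝ) + η) ^ 2 = n * r ^ 2 := by
    rw [hr_def]; nth_rewrite 2 [← hsq]; field_simp
  have e2 : n * (r - 1) ^ 2 = η ^ 2 := by
    rw [hr_def]; nth_rewrite 1 [← hsq]; field_simp; ring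
  have hr1 : 1 ≤ r := by rw [hr_def]; linarith [div_pos hη hs]
  have ht : 0 ≤ (1 - 1 / r ^ 2) / 2 := by
    have : 1 / r ^ 2 ≤ 1 := by
      rw [div_le_one (by positivity)]; exact one_le_pow₀ hr1
    linarith
  rw [← ofReal_measureReal]
  refine ENNReal.ofReal_le_ofReal ?_
  refine (measure_ge_le_exp_mul_mgf _ ht (integrable_exp_dotProduct_self n hr)).trans ?_
  rw [mgf_dotProduct_self n hr, e1]
  exact exp_mul_pow_le hr e2

lemma gaussVec_dotProduct_self_le (n : ℕ) {η : ℝ} (hη : 0 < η) (hn : η < √n) :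
    gaussVec n {x | x ⬝ᵥ x ≤ (√n - η) ^ 2} ≤ ENNReal.ofReal (Real.exp (-(η ^ 2 / 2))) := by
  have hs : 0 < √(n : ℝ) := hη.trans hn
  have hsq : √(n : ℝ) ^ 2 = n := Real.sq_sqrt (by positivity)
  set r := 1 - η / √n with hr_def
  have hr : 0 < r := by
    have := (div_lt_one hs).2 hn
    linarith
  have e1 : (√(n : ℝ) - η) ^ 2 = n * r ^ 2 := by
    rw [hr_def]; nth_rewrite 2 [← hsq]; field_simp
  have e2 : n * (r - 1) ^ 2 = η ^ 2 := by
    rw [hr_def]; nth_rewrite 1 [← hsq]; field_simp; ring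
  have hr1 : r ≤ 1 := by rw [hr_def]; linarith [div_pos hη hs]
  have ht : (1 - 1 / r ^ 2) / 2 ≤ 0 := by
    have : 1 ≤ 1 / r ^ 2 := by
      rw [le_div_iff₀ (by positivity), one_mul]; exact pow_le_one₀ hr.le hr1
    linarith
  rw [← ofReal_measureReal]
  refine ENNReal.ofReal_le_ofReal ?_
  refine (measure_le_le_exp_mul_mgf _ ht (integrable_exp_dotProduct_self n hr)).trans ?_
  rw [mgf_dotProduct_self n hr, e1]
  exact exp_mul_pow_le hr e2

/-! ### Invariance of Gaussian matrices -/

lemma measurePreserving_vecMul {n : ℕ} (U : Matrix (Fin n) (Fin n) ℝ) (hU : U * Uᵀ = 1) :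
    MeasurePreserving (fun x : Fin n → ℝ => x ᵥ* U) (gaussVec n) (gaussVec n) := by
  have hiso : ∀ x : Fin n → ℝ, (x ᵥ* U) ⬝ᵥ (x ᵥ* U) = x ⬝ᵥ x := fun x => by
    nth_rewrite 2 [← mulVec_transpose]
    rw [dotProduct_mulVec, vecMul_vecMul, hU, vecMul_one]
  -- The map is made a linear isometry of Euclidean space, so that `stdGaussian_map` applies.
  let T : EuclideanSpace ℝ (Fin n) →ₗ[ℝ] EuclideanSpace ℝ (Fin n) :=
    (WithLp.linearEquiv 2 ℝ (Fin n → ℝ)).symm.toLinearMap ∘ₗ U.vecMulLinear ∘ₗ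
      (WithLp.linearEquiv 2 ℝ (Fin n → ℝ)).toLinearMap
  have hT : ∀ x, T x = WithLp.toLp 2 ((WithLp.ofLp x) ᵥ* U) := fun x => rfl
  let Ti : EuclideanSpace ℝ (Fin n) →ₗᵢ[ℝ] EuclideanSpace ℝ (Fin n) := ⟨T, fun x => by
    have := hiso x.ofLp
    rw [hT, EuclideanSpace.norm_eq, EuclideanSpace.norm_eq]
    simpa [dotProduct, sq] using congrArg Real.sqrt this⟩
  let Te := Ti.toLinearIsometryEquiv rfl
  have hTe : ∀ x, Te x = WithLp.toLp 2 ((WithLp.ofLp x) ᵥ* U) := fun x => rfl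
  have key := stdGaussian_map Te
  have hm : Measurable (fun x : Fin n → ℝ => x ᵥ* U) := by
    have : Continuous (fun x : Fin n → ℝ => x ᵥ* U) := by fun_prop
    exact this.measurable
  refine ⟨hm, ?_⟩
  have h2 := map_pi_eq_stdGaussian (ι := Fin n)
  rw [← h2] at key
  have key2 := congrArg (Measure.map (WithLp.ofLp (p := 2) (V := Fin n → ℝ))) key
  rw [Measure.map_map (by fun_prop) (by fun_prop), Measure.map_map (by fun_prop) (by fun_prop),
    Measure.map_map (by fun_prop) (by fun_prop)] at key2
  have i1 : (WithLp.ofLp (p := 2) (V := Fin n → ℝ)) ∘ WithLp.toLp 2 = id := rfl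
  rw [i1, Measure.map_id] at key2
  exact key2

lemma measurePreserving_curry (m n : ℕ) :
    MeasurePreserving (MeasurableEquiv.curry (Fin m) (Fin n) ℝ)
      (Measure.pi fun _ => gaussianReal 0 1) (gaussMat m n) := by
  refine ⟨MeasurableEquiv.measurable _, ?_⟩
  have := Measure.infinitePi_map_curry (ι := Fin m) (κ := Fin n)
    (fun _ _ => gaussianReal 0 1)
  simpa only [Measure.infinitePi_eq_pi, gaussMat, gaussVec] using this

lemma measurePreserving_swap (m n : ℕ) :
    MeasurePreserving (fun (A : Fin m → Fin n → ℝ) j i => A i j)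
      (gaussMat m n) (gaussMat n m) := by
  have h1 := (measurePreserving_curry m n).symm
  have h2 := measurePreserving_piCongrLeft (α := fun _ => ℝ)
    (fun _ : Fin n × Fin m => gaussianReal 0 1) (Equiv.prodComm (Fin m) (Fin n))
  have h3 := (measurePreserving_curry n m).comp (h2.comp h1)
  convert h3 using 1
  ext A j i
  simp [MeasurableEquiv.curry, MeasurableEquiv.piCongrLeft, Equiv.piCongrLeft, Equiv.piCongrLeft']

lemma measurePreserving_mul_right {m n : ℕ} (U : Matrix (Fin n) (Fin n) ℝ) (hU : U * Uᵀ = 1) :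
    MeasurePreserving (fun (A : Fin m → Fin n → ℝ) i => A i ᵥ* U)
      (gaussMat m n) (gaussMat m n) :=
  measurePreserving_pi _ _ fun _ => measurePreserving_vecMul U hU

lemma measurePreserving_mul_left {m n : ℕ} (U : Matrix (Fin m) (Fin m) ℝ) (hU : U * Uᵀ = 1) :
    MeasurePreserving (fun (A : Fin m → Fin n → ℝ) => (fun i j => ((fun k => A k j) ᵥ* U) i))
      (gaussMat m n) (gaussMat m n) :=
  (measurePreserving_swap n m).comp
    ((measurePreserving_mul_right U hU).comp (measurePreserving_swap m n))

/-! ### Exposing a row or a column; Householder reflections -/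

lemma measurePreserving_splitRow (m n : ℕ) :
    MeasurePreserving (fun p : (Fin n → ℝ) × (Fin m → Fin n → ℝ) =>
        (Fin.cons p.1 p.2 : Fin (m + 1) → Fin n → ℝ))
      ((gaussVec n).prod (gaussMat m n)) (gaussMat (m + 1) n) := by
  have := (measurePreserving_piFinSuccAbove (fun _ : Fin (m + 1) => gaussVec n) 0).symm
  convert this using 1
  · ext p i
    simp [MeasurableEquiv.piFinSuccAbove, Fin.insertNthEquiv]
  all_goals rfl

lemma measurePreserving_splitVec (n : ℕ) :
    MeasurePreserving (fun p : ℝ × (Fin n → ℝ) => (Fin.cons p.1 p.2 : Fin (n + 1) → ℝ))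
      ((gaussianReal 0 1).prod (gaussVec n)) (gaussVec (n + 1)) := by
  have := (measurePreserving_piFinSuccAbove (fun _ : Fin (n + 1) => gaussianReal 0 1) 0).symm
  convert this using 1
  · ext p i
    simp [MeasurableEquiv.piFinSuccAbove, Fin.insertNthEquiv]
  all_goals rfl

lemma measurePreserving_splitCol (m n : ℕ) :
    MeasurePreserving (fun p : (Fin m → ℝ) × (Fin m → Fin n → ℝ) =>
        (fun i => Fin.cons (p.1 i) (p.2 i) : Fin m → Fin (n + 1) → ℝ))
      ((gaussVec m).prod (gaussMat m n)) (gaussMat m (n + 1)) := by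
  have h1 := (measurePreserving_arrowProdEquivProdArrow ℝ (Fin n → ℝ) (Fin m)
    (fun _ => gaussianReal 0 1) (fun _ => gaussVec n)).symm
  exact (measurePreserving_pi _ _ fun _ : Fin m => measurePreserving_splitVec n).comp h1

/-- A conditional union bound by Fubini: fibres over `G` are bounded by one, the others by `p`. -/
lemma prod_le_of_forall_notMem {X Y : Type*} [MeasurableSpace X] [MeasurableSpace Y]
    (μ : Measure X) [IsProbabilityMeasure μ] (ν : Measure Y) [IsProbabilityMeasure ν]
    {S : Set (X × Y)} (hS : MeasurableSet S) {G : Set X} (hG : MeasurableSet G) {p : ENNReal}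
    (h : ∀ x ∉ G, ν (Prod.mk x ⁻¹' S) ≤ p) : (μ.prod ν) S ≤ μ G + p := by
  rw [Measure.prod_apply hS]
  calc ∫⁻ x, ν (Prod.mk x ⁻¹' S) ∂μ ≤ ∫⁻ x, (G.indicator 1 x + p) ∂μ := by
        refine lintegral_mono fun x => ?_
        by_cases hx : x ∈ G
        · simpa [hx] using prob_le_one.trans (le_self_add : (1 : ENNReal) ≤ 1 + p)
        · simpa [hx] using h x hx
    _ = μ G + p := by
        rw [lintegral_add_right _ measurable_const, lintegral_indicator_one hG]
        simp

/-- Reflect in the hyperplane orthogonal to `w = v - |v| e₀`. The identity `w ⬝ᵥ w = 2 (v ⬝ᵥ w)`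
gives `v - w` as the image; if `w = 0`, the identity matrix serves. -/
lemma exists_householder {n : ℕ} (v : Fin (n + 1) → ℝ) :
    ∃ U : Matrix (Fin (n + 1)) (Fin (n + 1)) ℝ, Uᵀ = U ∧ U * U = 1 ∧
      v ᵥ* U = Pi.single 0 (√(v ⬝ᵥ v)) := by
  have hv : 0 ≤ v ⬝ᵥ v := by
    simpa using dotProduct_star_self_nonneg v
  set t := √(v ⬝ᵥ v) with ht
  have htt : t * t = v ⬝ᵥ v := Real.mul_self_sqrt hv
  set w : Fin (n + 1) → ℝ := v - Pi.single 0 t with hw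
  by_cases hw0 : w = 0
  · exact ⟨1, by simp, by simp, by simpa using sub_eq_zero.1 (hw ▸ hw0)⟩
  have hww : w ⬝ᵥ w ≠ 0 := by simpa using hw0
  have e1 : v ⬝ᵥ w = t * t - t * v 0 := by
    rw [hw, dotProduct_sub, dotProduct_single, htt]; ring
  have e2 : w ⬝ᵥ w = 2 * (t * t - t * v 0) := by
    nth_rewrite 1 [hw]
    rw [sub_dotProduct, e1, single_dotProduct, hw]
    simp; ring
  refine ⟨1 - (2 / (w ⬝ᵥ w)) • vecMulVec w w, ?_, ?_, ?_⟩
  · ext i j; simp [vecMulVec_apply, Matrix.one_apply, eq_comm, mul_comm]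
  · have : vecMulVec w w * vecMulVec w w = (w ⬝ᵥ w) • vecMulVec w w := by
      ext i j
      simp only [Matrix.mul_apply, vecMulVec_apply, Matrix.smul_apply, smul_eq_mul, dotProduct,
        Finset.sum_mul]
      exact Finset.sum_congr rfl fun _ _ => by ring
    rw [sub_mul, mul_sub, mul_sub, smul_mul_smul_comm, this, smul_smul]
    simp only [mul_one, one_mul]
    rw [show 2 / (w ⬝ᵥ w) * (2 / (w ⬝ᵥ w)) * (w ⬝ᵥ w) = 2 / (w ⬝ᵥ w) + 2 / (w ⬝ᵥ w) by
      field_simp; ring, add_smul]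
    abel
  · have h3 : v ᵥ* vecMulVec w w = (v ⬝ᵥ w) • w := by
      ext j
      simp [vecMul, dotProduct, vecMulVec_apply, Finset.sum_mul, mul_assoc]
    rw [vecMul_sub, vecMul_one, vecMul_smul, h3, smul_smul]
    have : 2 / (w ⬝ᵥ w) * (v ⬝ᵥ w) = 1 := by
      rw [e1, div_mul_eq_mul_div, ← e2, div_self hww]
    rw [this, one_smul, hw]; abel

/-! ### The smallest singular value -/

/-- The matrices `A` violating `s |u|² + c ⟨v, u⟩² ≤ |uᵀ A|²` for some `u`. -/
def badSet {m n : ℕ} (s c : ℝ) (v : Fin m → ℝ) : Set (Fin m → Fin n → ℝ) :=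
  {A | ∃ u : Fin m → ℝ,
    (u ᵥ* of A) ⬝ᵥ (u ᵥ* of A) < s * (u ⬝ᵥ u) + c * (v ⬝ᵥ u) ^ 2}

lemma isOpen_badSet {m n : ℕ} (s c : ℝ) (v : Fin m → ℝ) :
    IsOpen (badSet (n := n) s c v) := by
  have : badSet (n := n) s c v = ⋃ u : Fin m → ℝ, {A : Fin m → Fin n → ℝ |
      (u ᵥ* of A) ⬝ᵥ (u ᵥ* of A) < s * (u ⬝ᵥ u) + c * (v ⬝ᵥ u) ^ 2} := by
    ext A; simp [badSet]
  rw [this]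
  refine isOpen_iUnion fun u => isOpen_lt ?_ continuous_const
  have : Continuous fun A : Fin m → Fin n → ℝ => u ᵥ* of A := by
    refine continuous_pi fun j => ?_
    simp only [vecMul, dotProduct, of_apply]
    fun_prop
  fun_prop

lemma measurableSet_badSet {m n : ℕ} (s c : ℝ) (v : Fin m → ℝ) :
    MeasurableSet (badSet (n := n) s c v) :=
  (isOpen_badSet s c v).measurableSet

lemma dotProduct_vecMul_self {n : ℕ} {U : Matrix (Fin n) (Fin n) ℝ} (hU : U * Uᵀ = 1)
    (x y : Fin n → ℝ) : (x ᵥ* U) ⬝ᵥ (y ᵥ* U) = x ⬝ᵥ y := by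
  nth_rewrite 2 [← mulVec_transpose]
  rw [dotProduct_mulVec, vecMul_vecMul, hU, vecMul_one]

lemma gaussMat_badSet_mul_left {m n : ℕ} (s c : ℝ) (v : Fin m → ℝ)
    {U : Matrix (Fin m) (Fin m) ℝ} (hUt : Uᵀ = U) (hU : U * U = 1) :
    gaussMat m n (badSet s c v) = gaussMat m n (badSet s c (v ᵥ* U)) := by
  have hU' : U * Uᵀ = 1 := by rw [hUt, hU]
  rw [← (measurePreserving_mul_left U hU').measure_preimage
    (measurableSet_badSet s c (v ᵥ* U)).nullMeasurableSet]
  congr 1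
  ext A
  have key : ∀ u : Fin m → ℝ,
      u ᵥ* of (fun i j => ((fun k => A k j) ᵥ* U) i) = (u ᵥ* U) ᵥ* of A := fun u => by
    have : of (fun i j => ((fun k => A k j) ᵥ* U) i) = U * of A := by
      ext i j
      simp only [of_apply, vecMul, dotProduct, Matrix.mul_apply]
      refine Finset.sum_congr rfl fun k _ => ?_
      rw [← Matrix.transpose_apply U, hUt, mul_comm]
    rw [this, vecMul_vecMul]
  have hUU : ∀ x : Fin m → ℝ, x ᵥ* U ᵥ* U = x := fun x => by
    rw [vecMul_vecMul, hU, vecMul_one]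
  simp only [badSet, Set.mem_ofPred_eq, Set.mem_preimage, key]
  constructor
  · rintro ⟨u, hu⟩
    refine ⟨u ᵥ* U, ?_⟩
    rwa [hUU, dotProduct_vecMul_self hU', dotProduct_vecMul_self hU']
  · rintro ⟨u, hu⟩
    refine ⟨u ᵥ* U, ?_⟩
    rwa [dotProduct_vecMul_self hU', ← dotProduct_vecMul_self hU' v, hUU]

lemma cons_vecMul_cons {m n : ℕ} (u : Fin (m + 1) → ℝ) (a : Fin n → ℝ)
    (R : Fin m → Fin n → ℝ) :
    u ᵥ* of (Fin.cons a R : Fin (m + 1) → Fin n → ℝ) = u 0 • a + Fin.tail u ᵥ* of R := by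
  ext j
  simp [vecMul, dotProduct, Fin.sum_univ_succ, Fin.tail]

lemma gaussMat_cons_mem_badSet_rotate {m n : ℕ} (s c : ℝ) (v : Fin (m + 1) → ℝ) (a : Fin n → ℝ)
    {U : Matrix (Fin n) (Fin n) ℝ} (hU : U * Uᵀ = 1) :
    gaussMat m n {R | (Fin.cons a R : Fin (m + 1) → Fin n → ℝ) ∈ badSet s c v} =
      gaussMat m n {R | (Fin.cons (a ᵥ* U) R : Fin (m + 1) → Fin n → ℝ) ∈ badSet s c v} := by
  have hm : MeasurableSet
      {R : Fin m → Fin n → ℝ | (Fin.cons (a ᵥ* U) R : Fin (m + 1) → Fin n → ℝ) ∈ badSet s c v} :=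
    (((measurePreserving_splitRow m n).measurable.comp measurable_prodMk_left))
      (measurableSet_badSet s c v)
  rw [← (measurePreserving_mul_right U hU).measure_preimage hm.nullMeasurableSet]
  congr 1
  ext R
  have key : ∀ u : Fin m → ℝ, u ᵥ* of (fun i => R i ᵥ* U) = (u ᵥ* of R) ᵥ* U := fun u => by
    rw [vecMul_vecMul]; rfl
  simp only [badSet, Set.mem_ofPred_eq, Set.mem_preimage, cons_vecMul_cons, key,
    ← smul_vecMul, ← add_vecMul, dotProduct_vecMul_self hU]

lemma vecMul_cons_col {m n : ℕ} (u b : Fin m → ℝ) (B : Fin m → Fin n → ℝ) :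
    u ᵥ* of (fun i => (Fin.cons (b i) (B i) : Fin (n + 1) → ℝ))
      = (Fin.cons (b ⬝ᵥ u) (u ᵥ* of B) : Fin (n + 1) → ℝ) := by
  ext j
  refine Fin.cases ?_ (fun j => ?_) j <;> simp [vecMul, dotProduct, mul_comm]

lemma dotProduct_self_nonneg {n : ℕ} (u : Fin n → ℝ) : 0 ≤ u ⬝ᵥ u := by
  simpa using dotProduct_star_self_nonneg u

/-- The algebra of the induction step. With `y = b ⬝ᵥ u'`, where `u'` is the tail of `u`, the first
coordinate of `uᵀA` is `d u₀ + y`. Its square pays for the `u₀²` terms at the price of a negative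
multiple of `y²`, which the rank-one term for `B` covers. -/
lemma mem_badSet_of_cons_mem {m n : ℕ} {s c d D E : ℝ} (hE : 0 < E) (hED : E ≤ D) (hd : D ≤ d)
    (hs : s + c ≤ D ^ 2 - D * E) (b : Fin m → ℝ) (B : Fin m → Fin n → ℝ)
    (h : (Fin.cons (Pi.single 0 d) fun i => Fin.cons (b i) (B i) :
      Fin (m + 1) → Fin (n + 1) → ℝ) ∈ badSet s c (Pi.single 0 1)) :
    B ∈ badSet s (D * E - E ^ 2) (E⁻¹ • b) := by
  obtain ⟨u, hu⟩ := h
  refine ⟨Fin.tail u, ?_⟩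
  rw [cons_vecMul_cons, vecMul_cons_col] at hu
  have e1 : u 0 • (Pi.single 0 d : Fin (n + 1) → ℝ)
      + (Fin.cons (b ⬝ᵥ Fin.tail u) (Fin.tail u ᵥ* of B) : Fin (n + 1) → ℝ)
      = (Fin.cons (d * u 0 + b ⬝ᵥ Fin.tail u) (Fin.tail u ᵥ* of B) : Fin (n + 1) → ℝ) := by
    ext j
    refine Fin.cases ?_ (fun j => ?_) j <;> simp [mul_comm]
  have e2 : ∀ (k : ℕ) (x : ℝ) (y : Fin k → ℝ), (Fin.cons x y : Fin (k + 1) → ℝ) ⬝ᵥ Fin.cons x y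
      = x ^ 2 + y ⬝ᵥ y := fun k x y => by
    simp [dotProduct, Fin.sum_univ_succ, sq]
  have e3 : u ⬝ᵥ u = u 0 ^ 2 + Fin.tail u ⬝ᵥ Fin.tail u := by
    simp [dotProduct, Fin.sum_univ_succ, sq, Fin.tail]
  rw [e1, e2, e3, single_dotProduct, one_mul] at hu
  set q := (Fin.tail u ᵥ* of B) ⬝ᵥ (Fin.tail u ᵥ* of B)
  set w := Fin.tail u ⬝ᵥ Fin.tail u
  rw [smul_dotProduct, smul_eq_mul]
  set y := b ⬝ᵥ Fin.tail u
  have hD : 0 < D := hE.trans_le hED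
  -- The square to discard: the weight `E / D` leaves `(1 - E / D) d² u₀²`, at least `(D² - D E)
  -- u₀²`, against `(D E - E²)(y / E)²`.
  have k1 : 0 ≤ E / D * (d * u 0 + D / E * y) ^ 2 := by positivity
  have k2 : E / D * (d * u 0 + D / E * y) ^ 2
      = (d * u 0 + y) ^ 2 - (1 - E / D) * d ^ 2 * u 0 ^ 2 + (D * E - E ^ 2) * (E⁻¹ * y) ^ 2 := by
    field_simp; ring
  have k3 : (1 - E / D) * D ^ 2 = D ^ 2 - D * E := by field_simp
  have k4 : 0 ≤ 1 - E / D := by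
    have := (div_le_one hD).2 hED
    linarith
  have k5 : (1 - E / D) * D ^ 2 ≤ (1 - E / D) * d ^ 2 :=
    mul_le_mul_of_nonneg_left (pow_le_pow_left₀ hD.le hd 2) k4
  have k6 : (s + c) * u 0 ^ 2 ≤ (1 - E / D) * d ^ 2 * u 0 ^ 2 :=
    mul_le_mul_of_nonneg_right (by linarith) (sq_nonneg _)
  linarith

lemma measurableSet_dotProduct_lt {n : ℕ} (t : ℝ) :
    MeasurableSet {x : Fin n → ℝ | x ⬝ᵥ x < t} := by
  have : Continuous fun x : Fin n → ℝ => x ⬝ᵥ x := by fun_prop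
  exact (isOpen_lt this continuous_const).measurableSet

lemma measurableSet_lt_dotProduct {n : ℕ} (t : ℝ) :
    MeasurableSet {x : Fin n → ℝ | t < x ⬝ᵥ x} := by
  have : Continuous fun x : Fin n → ℝ => x ⬝ᵥ x := by fun_prop
  exact (isOpen_lt continuous_const this).measurableSet

/-- Condition on the first row, rotate it onto the first axis, then condition on the first column
below it. The rotation preserves the law of the other rows. -/
lemma gaussMat_badSet_single_le {m n : ℕ} {s c D E : ℝ} (hE : 0 < E) (hED : E ≤ D)
    (hs : s + c ≤ D ^ 2 - D * E) {p : ENNReal}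
    (hp : ∀ v : Fin m → ℝ, v ⬝ᵥ v ≤ 1 → gaussMat m n (badSet s (D * E - E ^ 2) v) ≤ p) :
    gaussMat (m + 1) (n + 1) (badSet s c (Pi.single 0 1)) ≤
      gaussVec (n + 1) {x | x ⬝ᵥ x < D ^ 2} + (gaussVec m {x | E ^ 2 < x ⬝ᵥ x} + p) := by
  have hS := measurableSet_badSet (n := n + 1) s c (Pi.single (0 : Fin (m + 1)) (1 : ℝ))
  rw [← (measurePreserving_splitRow m (n + 1)).measure_preimage hS.nullMeasurableSet]
  refine prod_le_of_forall_notMem _ _ ((measurePreserving_splitRow m (n + 1)).measurable hS)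
    (measurableSet_dotProduct_lt _) fun a ha => ?_
  obtain ⟨U, hUt, hU, hUa⟩ := exists_householder a
  have hd : D ≤ √(a ⬝ᵥ a) := Real.le_sqrt_of_sq_le (not_lt.1 ha)
  have hU' : U * Uᵀ = 1 := by rw [hUt, hU]
  refine (gaussMat_cons_mem_badSet_rotate s c _ a hU').trans_le ?_
  rw [hUa]
  set d := √(a ⬝ᵥ a)
  have hm : MeasurableSet {R : Fin m → Fin (n + 1) → ℝ |
      (Fin.cons (Pi.single 0 d) R : Fin (m + 1) → Fin (n + 1) → ℝ) ∈
        badSet s c (Pi.single 0 1)} :=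
    (((measurePreserving_splitRow m (n + 1)).measurable.comp measurable_prodMk_left)) hS
  rw [← (measurePreserving_splitCol m n).measure_preimage hm.nullMeasurableSet]
  refine prod_le_of_forall_notMem _ _ ((measurePreserving_splitCol m n).measurable hm)
    (measurableSet_lt_dotProduct _) fun b hb => ?_
  refine (measure_mono fun B hB => mem_badSet_of_cons_mem hE hED hd hs b B hB).trans (hp _ ?_)
  rw [smul_dotProduct, dotProduct_smul, smul_smul, smul_eq_mul, ← mul_inv, inv_mul_le_iff₀
    (by positivity), mul_one, ← sq]
  exact not_lt.1 hb

lemma gaussMat_badSet_le_single {m n : ℕ} {s c : ℝ} (hc : 0 ≤ c) (v : Fin (m + 1) → ℝ)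
    (hv : v ⬝ᵥ v ≤ 1) :
    gaussMat (m + 1) n (badSet s c v) ≤ gaussMat (m + 1) n (badSet s c (Pi.single 0 1)) := by
  obtain ⟨U, hUt, hU, hUv⟩ := exists_householder v
  rw [gaussMat_badSet_mul_left s c v hUt hU, hUv]
  refine measure_mono fun A => ?_
  rintro ⟨u, hu⟩
  refine ⟨u, hu.trans_le ?_⟩
  rw [single_dotProduct, single_dotProduct, one_mul, mul_pow, Real.sq_sqrt (dotProduct_self_nonneg v)]
  gcongr
  exact mul_le_of_le_one_left (sq_nonneg _) hv

lemma sqrt_succ_sub_sqrt_anti {a b : ℝ} (ha : 0 ≤ a) (hab : a ≤ b) :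
    √(b + 1) - √b ≤ √(a + 1) - √a := by
  have h1 : ∀ x : ℝ, 0 ≤ x → (√(x + 1) - √x) * (√(x + 1) + √x) = 1 := fun x hx => by
    have e1 := Real.mul_self_sqrt (by linarith : 0 ≤ x + 1)
    have e2 := Real.mul_self_sqrt hx
    linarith
  have ha1 := h1 a ha
  have hb1 := h1 b (ha.trans hab)
  have l1 := Real.sqrt_le_sqrt hab
  have l2 := Real.sqrt_le_sqrt (by linarith : a + 1 ≤ b + 1)
  have p1 : 0 < √(a + 1) := Real.sqrt_pos.2 (by linarith)
  have p2 := Real.sqrt_nonneg a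
  have p4 : 0 ≤ √(b + 1) - √b := sub_nonneg.2 (Real.sqrt_le_sqrt (by linarith))
  refine le_of_mul_le_mul_right ?_ (by linarith : 0 < √(a + 1) + √a)
  refine (mul_le_mul_of_nonneg_left (?_ : _ ≤ √(b + 1) + √b) p4).trans (hb1.trans ha1.symm).le
  linarith

lemma sqrt_succ_le (a : ℝ) (ha : 0 ≤ a) : √(a + 1) ≤ √a + 1 := by
  have := sqrt_succ_sub_sqrt_anti le_rfl ha
  simp at this
  linarith

/-- A sharp lower tail bound for the smallest singular value of a Gaussian matrix. -/
lemma gaussMat_badSet_le {η τ s : ℝ} (hη : 0 < η) (hτ : 0 ≤ τ) (hs : s ≤ τ ^ 2 - τ) (r : ℕ) :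
    ∀ m : ℕ, √(m : ℝ) + 2 * η + τ ≤ √((r + m : ℕ) : ℝ) →
      ∀ v : Fin m → ℝ, v ⬝ᵥ v ≤ 1 →
        gaussMat m (r + m) (badSet s (τ * (√((m : ℝ) + 1) + η)) v) ≤
          (2 * m : ℕ) * ENNReal.ofReal (Real.exp (-(η ^ 2 / 2)))
  | 0, _, v, _ => by
    have : badSet (m := 0) (n := r + 0) s (τ * (√(((0 : ℕ) : ℝ) + 1) + η)) v = ∅ := by
      ext A
      simp only [badSet, Set.mem_ofPred_eq, Set.mem_empty_iff_false, iff_false]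
      rintro ⟨u, hu⟩
      simp [dotProduct, vecMul] at hu
    rw [this, measure_empty]
    exact zero_le
  | m + 1, hm, v, hv => by
    set q := ENNReal.ofReal (Real.exp (-(η ^ 2 / 2))) with hq
    push_cast at hm
    -- The gap `√(r + m) - √m` does not shrink as `m` decreases, because increments of the square
    -- root decrease.
    have hm' : √(m : ℝ) + 2 * η + τ ≤ √((r + m : ℕ) : ℝ) := by
      have := sqrt_succ_sub_sqrt_anti (Nat.cast_nonneg m)
        (by push_cast; linarith [Nat.cast_nonneg (α := ℝ) r] : (m : ℝ) ≤ ((r + m : ℕ) : ℝ))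
      push_cast at this ⊢
      rw [add_assoc (r : ℝ)] at this
      linarith
    -- With `D = E + τ`, the new rank-one coefficient `D E - E²` is `τ E`, the one in the inductive
    -- hypothesis.
    set E := √((m : ℝ) + 1) + η with hE_def
    have hE : 0 < E := by positivity
    have ih : ∀ v : Fin m → ℝ, v ⬝ᵥ v ≤ 1 → gaussMat m (r + m)
        (badSet s ((E + τ) * E - E ^ 2) v) ≤ (2 * m : ℕ) * q := by
      rw [show (E + τ) * E - E ^ 2 = τ * E by ring]
      exact gaussMat_badSet_le hη hτ hs r m hm'
    have hss := sqrt_succ_le ((m : ℝ) + 1) (by positivity)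
    refine (gaussMat_badSet_le_single (by positivity) v hv).trans ?_
    refine (gaussMat_badSet_single_le hE (by linarith) ?_ ih).trans ?_
    -- Here `D² - D E = τ (E + τ)`, and `√(m + 2) ≤ √(m + 1) + 1` costs the `-τ` in `s ≤ τ² - τ`.
    · push_cast
      have := mul_le_mul_of_nonneg_left hss hτ
      rw [hE_def]
      linarith
    · have t1 : gaussVec (r + m + 1) {x | x ⬝ᵥ x < (E + τ) ^ 2} ≤ q := by
        have hle : E + τ ≤ √((r + m + 1 : ℕ) : ℝ) - η := by
          push_cast; rw [add_assoc (r : ℝ), hE_def]; linarith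
        refine (measure_mono fun x hx => ?_).trans
          (gaussVec_dotProduct_self_le (r + m + 1) hη (by linarith))
        exact hx.le.trans (pow_le_pow_left₀ (by positivity) hle 2)
      have t2 : gaussVec m {x | E ^ 2 < x ⬝ᵥ x} ≤ q := by
        refine (measure_mono fun x hx => ?_).trans (gaussVec_le_dotProduct_self m hη)
        have := Real.sqrt_le_sqrt (by linarith : (m : ℝ) ≤ m + 1)
        have hle : √(m : ℝ) + η ≤ E := by linarith
        have hx' : E ^ 2 < x ⬝ᵥ x := hx
        exact (pow_le_pow_left₀ (by positivity) hle 2).trans hx'.le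
      calc _ ≤ q + (q + (2 * m : ℕ) * q) := by gcongr
        _ = (2 * (m + 1) : ℕ) * q := by push_cast; ring

/-- Gaussian matrices with at least as many columns as rows are well conditioned with positive
probability. -/
lemma gaussMat_badSet_lt_one {m n : ℕ} (hmn : m ≤ n) {s : ℝ} (hs : 0 ≤ s) :
    gaussMat m n (badSet s 0 0) < 1 := by
  have : (gaussianReal 0 1).IsOpenPosMeasure :=
    (gaussianReal_absolutelyContinuous' 0 one_ne_zero).isOpenPosMeasure
  have : (gaussVec n).IsOpenPosMeasure := Measure.pi.isOpenPosMeasure _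
  have : (gaussMat m n).IsOpenPosMeasure := Measure.pi.isOpenPosMeasure _
  -- Near `T [I 0]`, each of the `m` leading coordinates loses at most `m |u|²`, so `T² / 2` must
  -- exceed `s` by `m²`.
  set T := √(2 * (s + m ^ 2)) with hT
  have hTT : T ^ 2 = 2 * (s + m ^ 2) := Real.sq_sqrt (by positivity)
  let A₀ : Fin m → Fin n → ℝ := fun i j => if Fin.castLE hmn i = j then T else 0
  have hsub : Metric.ball A₀ 1 ⊆ (badSet s 0 0)ᶜ := by
    rintro A hA ⟨u, hu⟩
    have hB : ∀ i j, |A i j - A₀ i j| ≤ 1 := fun i j => by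
      have h1 := (dist_le_pi_dist A A₀ i)
      have h2 := (dist_le_pi_dist (A i) (A₀ i) j)
      rw [Real.dist_eq] at h2
      exact (h2.trans h1).trans (Metric.mem_ball.1 hA).le
    have hu0 := dotProduct_self_nonneg u
    have hy : ∀ j, (∑ i, u i * (A i j - A₀ i j)) ^ 2 ≤ m * (u ⬝ᵥ u) := fun j => by
      refine (Finset.sum_mul_sq_le_sq_mul_sq _ _ _).trans ?_
      rw [mul_comm]
      refine mul_le_mul ?_ (by simp [dotProduct, sq]) (by positivity) (by positivity)
      refine (Finset.sum_le_sum fun i _ => (sq_le_one_iff_abs_le_one _).2 (hB i j)).trans ?_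
      simp
    have hrow : ∀ i, T ^ 2 / 2 * u i ^ 2 - m * (u ⬝ᵥ u) ≤
        (u ᵥ* of A) (Fin.castLE hmn i) ^ 2 := fun i => by
      have e : (u ᵥ* of A) (Fin.castLE hmn i)
          = T * u i + ∑ k, u k * (A k (Fin.castLE hmn i) - A₀ k (Fin.castLE hmn i)) := by
        simp only [mul_sub, Finset.sum_sub_distrib, vecMul, dotProduct, of_apply]
        simp [A₀, mul_comm]
      rw [e]
      nlinarith [hy (Fin.castLE hmn i), sq_nonneg (T * u i + 2 * ∑ k, u k *
        (A k (Fin.castLE hmn i) - A₀ k (Fin.castLE hmn i)))]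
    have hsum : ∑ i, (u ᵥ* of A) (Fin.castLE hmn i) ^ 2 ≤ (u ᵥ* of A) ⬝ᵥ (u ᵥ* of A) := by
      simp only [dotProduct, ← sq]
      rw [← Finset.sum_image (f := fun j => (u ᵥ* of A) j ^ 2) (g := Fin.castLE hmn)
        (fun a _ b _ h => Fin.castLE_injective hmn h)]
      exact Finset.sum_le_sum_of_subset_of_nonneg (Finset.subset_univ _)
        fun _ _ _ => sq_nonneg _
    have h3 := Finset.sum_le_sum fun i (_ : i ∈ Finset.univ) => hrow i
    rw [Finset.sum_sub_distrib, ← Finset.mul_sum] at h3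
    have h4 : ∑ i, u i ^ 2 = u ⬝ᵥ u := by simp [dotProduct, sq]
    simp only [h4, Finset.sum_const, Finset.card_univ, Fintype.card_fin, nsmul_eq_mul] at h3
    rw [hTT] at h3
    simp only [zero_mul, add_zero] at hu
    linarith
  have hpos : 0 < gaussMat m n (badSet s 0 0)ᶜ :=
    (Metric.isOpen_ball.measure_pos _ ⟨A₀, Metric.mem_ball_self one_pos⟩).trans_le
      (measure_mono hsub)
  rw [prob_compl_eq_one_sub (measurableSet_badSet s 0 0)] at hpos
  exact tsub_pos_iff_lt.1 hpos

/-! ### The deterministic reduction -/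

lemma exists_preimage_of_notMem_badSet {m n : ℕ} {s : ℝ} (hs : 0 < s)
    (A : Matrix (Fin m) (Fin n) ℝ) (hA : (A : Fin m → Fin n → ℝ) ∉ badSet (s ^ 2) 0 0)
    (w : EuclideanSpace ℝ (Fin m)) :
    ∃ x : EuclideanSpace ℝ (Fin n), Matrix.toEuclideanLin A x = w ∧ s * ‖x‖ ≤ ‖w‖ := by
  have hlow : ∀ u : Fin m → ℝ, s ^ 2 * (u ⬝ᵥ u) ≤ (u ᵥ* A) ⬝ᵥ (u ᵥ* A) := fun u => by
    by_contra h
    refine hA ⟨u, ?_⟩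
    rw [zero_mul, add_zero]
    exact not_le.1 h
  -- The preimage will be `Aᵀ (A Aᵀ)⁻¹ w`; injectivity of the square matrix `A Aᵀ` gives
  -- surjectivity.
  have hinj : Function.Injective (A * Aᵀ).mulVecLin := by
    rw [← LinearMap.ker_eq_bot, LinearMap.ker_eq_bot']
    intro u hu
    rw [mulVecLin_apply, ← mulVec_mulVec, mulVec_transpose] at hu
    have h1 := hlow u
    rw [← dotProduct_mulVec, hu, dotProduct_zero] at h1
    have h2 : u ⬝ᵥ u ≤ 0 := nonpos_of_mul_nonpos_right h1 (by positivity)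
    exact dotProduct_self_eq_zero.1 (le_antisymm h2 (dotProduct_self_nonneg u))
  obtain ⟨u, hu⟩ := LinearMap.injective_iff_surjective.1 hinj w.ofLp
  rw [mulVecLin_apply, ← mulVec_mulVec, mulVec_transpose] at hu
  have hnorm : ∀ (k : ℕ) (x : EuclideanSpace ℝ (Fin k)), ‖x‖ ^ 2 = x.ofLp ⬝ᵥ x.ofLp :=
    fun k x => by rw [EuclideanSpace.real_norm_sq_eq]; simp [dotProduct, sq]
  refine ⟨WithLp.toLp 2 (u ᵥ* A), ?_, ?_⟩
  · rw [Matrix.toLpLin_apply]; exact congrArg (WithLp.toLp 2) hu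
  · have h1 := hlow u
    set x : EuclideanSpace ℝ (Fin n) := WithLp.toLp 2 (u ᵥ* A) with hx
    set u' : EuclideanSpace ℝ (Fin m) := WithLp.toLp 2 u with hu'
    have ex : ‖x‖ ^ 2 = (u ᵥ* A) ⬝ᵥ (u ᵥ* A) := hnorm n x
    have eu : ‖u'‖ ^ 2 = u ⬝ᵥ u := hnorm m u'
    have ei : ‖x‖ ^ 2 = inner ℝ u' w := by
      rw [ex, ← dotProduct_mulVec, hu]
      simp [PiLp.inner_apply, dotProduct, hu', mul_comm]
    have h2 : ‖x‖ ^ 2 ≤ ‖u'‖ * ‖w‖ := ei.trans_le (real_inner_le_norm u' w)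
    have h3 : s * ‖u'‖ ≤ ‖x‖ := by
      refine le_of_sq_le_sq ?_ (norm_nonneg _)
      rw [mul_pow, ex, eu]; exact h1
    rcases (norm_nonneg x).eq_or_lt with h0 | h0
    · rw [← h0, mul_zero]; exact norm_nonneg _
    · refine le_of_mul_le_mul_right ?_ h0
      calc s * ‖x‖ * ‖x‖ = s * ‖x‖ ^ 2 := by ring
        _ ≤ s * (‖u'‖ * ‖w‖) := by gcongr
        _ = (s * ‖u'‖) * ‖w‖ := by ring
        _ ≤ ‖x‖ * ‖w‖ := by gcongr
        _ = ‖w‖ * ‖x‖ := by ring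

lemma exists_feasible_of_notMem_badSet {m n : ℕ} {s lam : ℝ} {L : NNReal} (hlam : 0 ≤ lam)
    (hs : lam * L < s) {f : EuclideanSpace ℝ (Fin n) → ℝ} (hf : LipschitzWith L f)
    (A : Matrix (Fin m) (Fin n) ℝ) (hA : (A : Fin m → Fin n → ℝ) ∉ badSet (s ^ 2) 0 0)
    (y : EuclideanSpace ℝ (Fin m)) (x : EuclideanSpace ℝ (Fin n)) :
    ∃ x', y = Matrix.toEuclideanLin A x' ∧ lam * f x' ≤ cost f lam A y x ∧
      (y ≠ Matrix.toEuclideanLin A x → lam * f x' < cost f lam A y x) := by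
  have hlL : 0 ≤ lam * L := by positivity
  have hs0 : 0 < s := hlL.trans_lt hs
  obtain ⟨h, hAh, hh⟩ := exists_preimage_of_notMem_badSet hs0 A hA
    (y - Matrix.toEuclideanLin A x)
  have hfx : f (x + h) ≤ f x + L * ‖h‖ := by
    have := hf.dist_le_mul (x + h) x
    rw [Real.dist_eq, dist_eq_norm, add_sub_cancel_left] at this
    linarith [le_abs_self (f (x + h) - f x)]
  have h1 : lam * f (x + h) ≤ lam * f x + lam * L * ‖h‖ := by
    have := mul_le_mul_of_nonneg_left hfx hlam
    linarith
  have h2 : lam * L * ‖h‖ ≤ s * ‖h‖ := mul_le_mul_of_nonneg_right hs.le (norm_nonneg h)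
  refine ⟨x + h, by rw [map_add, hAh]; abel, ?_, fun hne => ?_⟩
  · rw [cost]; linarith
  · have hh0 : 0 < ‖h‖ := by
      rw [norm_pos_iff]
      rintro rfl
      rw [map_zero] at hAh
      exact hne (sub_eq_zero.1 hAh.symm)
    have := mul_lt_mul_of_pos_right hs hh0
    rw [cost]; linarith

lemma cost_eq_of_feasible {m n : ℕ} {f : EuclideanSpace ℝ (Fin n) → ℝ} {lam : ℝ}
    {A : Matrix (Fin m) (Fin n) ℝ} {y : EuclideanSpace ℝ (Fin m)}
    {x : EuclideanSpace ℝ (Fin n)} (h : y = Matrix.toEuclideanLin A x) :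
    cost f lam A y x = lam * f x := by
  rw [cost, ← h, sub_self, norm_zero, zero_add]

lemma exact_recovery_of_notMem_badSet {m n : ℕ} {s lam : ℝ} {L : NNReal} (hlam : 0 ≤ lam)
    (hs : lam * L < s) {f : EuclideanSpace ℝ (Fin n) → ℝ} (hf : LipschitzWith L f)
    (A : Matrix (Fin m) (Fin n) ℝ) (hA : (A : Fin m → Fin n → ℝ) ∉ badSet (s ^ 2) 0 0)
    (y : EuclideanSpace ℝ (Fin m)) :
    (∀ x, IsSolution f lam A y x → y = Matrix.toEuclideanLin A x) ∧
      (0 < lam → ∀ x, IsSolution f lam A y x ↔ IsNoiselessSolution f A y x) := by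
  have key := exists_feasible_of_notMem_badSet hlam hs hf A hA y
  have hfeas : ∀ x, IsSolution f lam A y x → y = Matrix.toEuclideanLin A x := fun x hx => by
    by_contra hne
    obtain ⟨x', hx', -, hlt⟩ := key x
    have := hx x'
    rw [cost_eq_of_feasible hx'] at this
    exact absurd this (not_le.2 (hlt hne))
  refine ⟨hfeas, fun hpos x => ⟨fun hx => ⟨hfeas x hx, fun x' hx' => ?_⟩, fun hx x' => ?_⟩⟩
  · have := hx x'
    rw [cost_eq_of_feasible (hfeas x hx), cost_eq_of_feasible hx'] at this
    exact le_of_mul_le_mul_left this hpos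
  · obtain ⟨x'', hx'', hle, -⟩ := key x'
    rw [cost_eq_of_feasible hx.1]
    exact (mul_le_mul_of_nonneg_left (hx.2 x'' hx'') hlam).trans hle

/-! ### The probability bound -/

lemma measure_mem_badSet {Ω : Type*} [MeasurableSpace Ω] {μ : Measure Ω} {m n : ℕ} {σ : ℝ}
    {A : Ω → Matrix (Fin m) (Fin n) ℝ} {z : Ω → EuclideanSpace ℝ (Fin m)}
    (h : IsGaussianModel μ σ A z) (s c : ℝ) (v : Fin m → ℝ) :
    μ {ω | (A ω : Fin m → Fin n → ℝ) ∈ badSet s c v} = gaussMat m n (badSet s c v) := by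
  have h1 : HasLaw (fun ω (p : Fin m × Fin n) => A ω p.1 p.2)
      (Measure.pi fun _ => gaussianReal 0 1) μ :=
    h.entry_indep.hasLaw_pi fun p => h.entry_law p.1 p.2
  have h2 : HasLaw (fun ω => (A ω : Fin m → Fin n → ℝ)) (gaussMat m n) μ :=
    (measurePreserving_curry m n).comp_hasLaw h1
  exact h2.measure_eq (p := fun B => B ∈ badSet s c v) (measurableSet_badSet s c v)

lemma gaussMat_badSet_le_of_le_sub {m n : ℕ} (hmn : m ≤ n) {s η : ℝ} (hs : 0 ≤ s) (hη : 0 < η)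
    (h : s + 1 + 2 * η ≤ √(n : ℝ) - √(m : ℝ)) :
    gaussMat m n (badSet (s ^ 2) 0 0) ≤
      (2 * m : ℕ) * ENNReal.ofReal (Real.exp (-(η ^ 2 / 2))) := by
  obtain ⟨r, rfl⟩ := Nat.exists_eq_add_of_le' hmn
  -- Take `τ = s + 1`, so that `τ² - τ = s² + s`; the choice `v = 0` removes the rank-one term.
  refine le_trans (measure_mono ?_) (gaussMat_badSet_le hη (by linarith : 0 ≤ s + 1)
    (by nlinarith : s ^ 2 ≤ (s + 1) ^ 2 - (s + 1)) r m (by linarith) 0 (by simp))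
  rintro A ⟨u, hu⟩
  exact ⟨u, by simpa using hu⟩

lemma eventually_two_mul_exp_le {a : ℝ} (ha : 0 < a) :
    ∀ᶠ n : ℕ in Filter.atTop, 2 * (n : ℝ) * Real.exp (-(2 * a * n)) ≤ Real.exp (-(a * n)) := by
  have h1 : Filter.Tendsto (fun x : ℝ => x ^ 1 * Real.exp (-a * x)) Filter.atTop (nhds 0) := by
    simpa using tendsto_rpow_mul_exp_neg_mul_atTop_nhds_zero 1 a ha
  have h2 := (h1.comp tendsto_natCast_atTop_atTop).eventually
    (Iic_mem_nhds (show (0 : ℝ) < 1 / 2 by norm_num))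
  filter_upwards [h2] with n hn
  simp only [Function.comp_apply, pow_one] at hn
  have e : Real.exp (-(2 * a * n)) = Real.exp (-a * n) * Real.exp (-(a * n)) := by
    rw [← Real.exp_add]; congr 1; ring
  rw [e]
  have := mul_le_mul_of_nonneg_right hn (Real.exp_pos (-(a * n))).le
  linarith

lemma eventually_le_ofReal_exp {p : ENNReal} (hp : p < 1) (n : ℕ) :
    ∀ᶠ C : ℝ in nhdsWithin 0 (Set.Ioi 0), p ≤ ENNReal.ofReal (Real.exp (-(C * n))) := by
  have hc : Continuous fun C : ℝ => ENNReal.ofReal (Real.exp (-(C * n))) :=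
    ENNReal.continuous_ofReal.comp (by fun_prop)
  have h := hc.tendsto 0
  simp only [zero_mul, neg_zero, Real.exp_zero, ENNReal.ofReal_one] at h
  exact ((h.mono_left nhdsWithin_le_nhds).eventually (lt_mem_nhds hp)).mono fun _ h => h.le

/-- The smallest singular value of an `m × n` Gaussian matrix with `√m ≤ β √n`, `β < 1`, is at
least `(1 - ε) (√n - √m)` with exponentially high probability. -/
lemma exists_gaussMat_badSet_le {β ε : ℝ} (hβ : β < 1) (hε : 0 < ε) (hε1 : ε < 1) :
    ∃ C : ℝ, 0 < C ∧ ∀ m n : ℕ, √(m : ℝ) ≤ β * √(n : ℝ) →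
      gaussMat m n (badSet (((√(n : ℝ) - √(m : ℝ)) * (1 - ε)) ^ 2) 0 0) ≤
        ENNReal.ofReal (Real.exp (-(C * n))) := by
  set κ := 1 - β with hκ
  have hκ0 : 0 < κ := by linarith
  -- With `η = δ √n`, the term `2 η` uses half of the slack `ε κ √n`; the other half covers the
  -- additive `1` for large `n`.
  set δ := ε * κ / 4 with hδ
  have hδ0 : 0 < δ := by positivity
  have hmn : ∀ m n : ℕ, √(m : ℝ) ≤ β * √(n : ℝ) → m ≤ n := fun m n h => by
    have h1 : √(m : ℝ) ≤ √(n : ℝ) := h.trans (mul_le_of_le_one_left (Real.sqrt_nonneg _) hβ.le)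
    exact_mod_cast (Real.sqrt_le_sqrt_iff (Nat.cast_nonneg n)).1 h1
  have hΔ : ∀ m n : ℕ, √(m : ℝ) ≤ β * √(n : ℝ) → κ * √(n : ℝ) ≤ √(n : ℝ) - √(m : ℝ) :=
    fun m n h => by rw [hκ]; linarith
  have hlarge : ∀ᶠ n : ℕ in Filter.atTop, 2 / (ε * κ) ≤ √(n : ℝ) :=
    (Real.tendsto_sqrt_atTop.comp tendsto_natCast_atTop_atTop).eventually_ge_atTop _
  obtain ⟨N, hN⟩ := Filter.eventually_atTop.1
    (hlarge.and (eventually_two_mul_exp_le (by positivity : 0 < δ ^ 2 / 4)))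
  have hsmall : ∀ᶠ C : ℝ in nhdsWithin 0 (Set.Ioi 0), ∀ q ∈ Finset.range N ×ˢ Finset.range N,
      q.1 ≤ q.2 →
      gaussMat q.1 q.2 (badSet (((√(q.2 : ℝ) - √(q.1 : ℝ)) * (1 - ε)) ^ 2) 0 0) ≤
        ENNReal.ofReal (Real.exp (-(C * q.2))) := by
    rw [Filter.eventually_all_finset]
    intro q _
    by_cases hq : q.1 ≤ q.2
    · exact (eventually_le_ofReal_exp (gaussMat_badSet_lt_one hq (sq_nonneg _)) q.2).mono
        fun _ h _ => h
    · exact Filter.Eventually.of_forall fun _ h => absurd h hq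
  have hle : ∀ᶠ C : ℝ in nhdsWithin 0 (Set.Ioi 0), C ≤ δ ^ 2 / 4 :=
    nhdsWithin_le_nhds (Iic_mem_nhds (by positivity))
  obtain ⟨C, ⟨hC, hCle⟩, hC0⟩ := ((hsmall.and hle).and self_mem_nhdsWithin).exists
  refine ⟨C, hC0, fun m n h => ?_⟩
  have hmn' := hmn m n h
  rcases lt_or_ge n N with hn | hn
  · exact hC (m, n) (by simp; omega) hmn'
  obtain ⟨hn1, hn2⟩ := hN n hn
  have hs0 : 0 < √(n : ℝ) := lt_of_lt_of_le (by positivity) hn1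
  have hn3 : 2 ≤ ε * κ * √(n : ℝ) := by
    rwa [div_le_iff₀ (by positivity), mul_comm] at hn1
  have hD := hΔ m n h
  have hD0 : 0 ≤ √(n : ℝ) - √(m : ℝ) := le_trans (by positivity) hD
  have hεD : ε * κ * √(n : ℝ) ≤ ε * (√(n : ℝ) - √(m : ℝ)) := by
    rw [mul_assoc]; exact mul_le_mul_of_nonneg_left hD hε.le
  refine (gaussMat_badSet_le_of_le_sub hmn' (mul_nonneg hD0 (by linarith))
    (by positivity : 0 < δ * √(n : ℝ)) ?_).trans ?_
  · rw [hδ]; linarith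
  · rw [← ENNReal.ofReal_natCast, ← ENNReal.ofReal_mul (by positivity)]
    refine ENNReal.ofReal_le_ofReal ?_
    -- Half of this exponent absorbs the prefactor `2 n`.
    have hsq : (δ * √(n : ℝ)) ^ 2 / 2 = 2 * (δ ^ 2 / 4) * n := by
      rw [mul_pow, Real.sq_sqrt (Nat.cast_nonneg n)]; ring
    rw [hsq]
    push_cast
    calc 2 * (m : ℝ) * Real.exp (-(2 * (δ ^ 2 / 4) * n))
        ≤ 2 * (n : ℝ) * Real.exp (-(2 * (δ ^ 2 / 4) * n)) := by gcongr
      _ ≤ Real.exp (-(δ ^ 2 / 4 * n)) := hn2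
      _ ≤ Real.exp (-(C * n)) := by gcongr

end EllTwoLasso

theorem mainTheorem10 (α ε : ℝ) (hα : α < 1) (hε : 0 < ε) :
    ∃ C : ℝ, 0 < C ∧
      ∀ (m n : ℕ), (m : ℝ) ≤ α * n →
      ∀ (f : EuclideanSpace ℝ (Fin n) → ℝ) (L : NNReal), 0 < L → LipschitzWith L f →
      ∀ (lam : ℝ), 0 ≤ lam →
        lam < (Real.sqrt n - Real.sqrt m) / (L : ℝ) * (1 - ε) →
      ∀ (σ : ℝ) (x₀ : EuclideanSpace ℝ (Fin n))
        {Ω : Type*} [MeasurableSpace Ω] (μ : Measure Ω) [IsProbabilityMeasure μ]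
        (A : Ω → Matrix (Fin m) (Fin n) ℝ) (z y : Ω → EuclideanSpace ℝ (Fin m)),
        EllTwoLasso.IsGaussianModel μ σ A z →
        (∀ ω, y ω = Matrix.toEuclideanLin (A ω) x₀ + z ω) →
        μ {ω | ¬ ((∀ x, EllTwoLasso.IsSolution f lam (A ω) (y ω) x →
                      y ω = Matrix.toEuclideanLin (A ω) x) ∧
                  (0 < lam → ∀ x, EllTwoLasso.IsSolution f lam (A ω) (y ω) x ↔
                      EllTwoLasso.IsNoiselessSolution f (A ω) (y ω) x))}
          ≤ ENNReal.ofReal (Real.exp (-(C * n))) := by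
  rcases lt_or_ge ε 1 with hε1 | hε1
  -- The maximum with `0` allows negative `α`.
  · have hβ : √(max α 0) < 1 := by
      rw [Real.sqrt_lt' one_pos]; simpa using hα
    obtain ⟨C, hC0, hC⟩ := EllTwoLasso.exists_gaussMat_badSet_le hβ hε hε1
    refine ⟨C, hC0, fun m n hmn f L hL hf lam hlam hlt σ x₀ Ω _ μ _ A z y hG _ => ?_⟩
    have hL' : (0 : ℝ) < L := hL
    have hs : lam * L < (√(n : ℝ) - √(m : ℝ)) * (1 - ε) := by
      rwa [div_mul_eq_mul_div, lt_div_iff₀ hL'] at hlt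
    have hm : √(m : ℝ) ≤ √(max α 0) * √(n : ℝ) := by
      rw [← Real.sqrt_mul (le_max_right α 0)]
      exact Real.sqrt_le_sqrt
        (hmn.trans (mul_le_mul_of_nonneg_right (le_max_left α 0) (Nat.cast_nonneg n)))
    refine le_trans (measure_mono fun ω hω => ?_)
      ((EllTwoLasso.measure_mem_badSet hG _ 0 0).trans_le (hC m n hm))
    by_contra hA
    exact hω (EllTwoLasso.exact_recovery_of_notMem_badSet hlam hs hf (A ω) hA (y ω))
  -- For `ε ≥ 1` the upper bound on `lam` is nonpositive, so no `lam` is admissible.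
  · refine ⟨1, one_pos, fun m n hmn f L hL hf lam hlam hlt => absurd (hlam.trans_lt hlt) ?_⟩
    have hmn' : √(m : ℝ) ≤ √(n : ℝ) := Real.sqrt_le_sqrt
      (hmn.trans (mul_le_of_le_one_left (Nat.cast_nonneg n) hα.le))
    exact not_lt.2 (mul_nonpos_of_nonneg_of_nonpos
      (div_nonneg (sub_nonneg.2 hmn') L.coe_nonneg) (by linarith))
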